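/- Let $\mathbb{D}=\{z\in\mathbb{C}:|z|<1\}$ be the open unit disk, and for a function $f$ analytic on $\mathbb{D}$ let $$\|f\|_{\mathcal{B}}=|f(0)|+\sup_{z\in\mathbb{D}}(1-|z|^2)\,|f'(z)|$$ denote its Bloch norm. Let $\lambda_1,\lambda_2$ be nonzero complex numbers with $\lambda_1+\lambda_2\neq 0$, and let $\varphi,\psi:\mathbb{D}\to\mathbb{D}$ be analytic. Write $\varphi^n,\psi^n$ for the pointwise $n$-th powers, $\varphi^n(z)=(\varphi(z))^n$ and $\psi^n(z)=(\psi(z))^n$. Then $$\lim_{n\to\infty}\|\lambda_1\varphi^n+\lambda_2\psi^n\|_{\mathcal{B}}=0$$ if and only if both $\lim_{n\to\infty}\|\varphi^n\|_{\mathcal{B}}=0$ and $\lim_{n\to\infty}\|\psi^n\|_{\mathcal{B}}=0$. -/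

import Mathlib

open Filter Topology
open scoped ENNReal

/-- The Bloch seminorm `sup_{|z| < 1} (1 - |z|²) |f'(z)|` of a function on the open unit disk,
as an extended nonnegative real (so that it is `∞` exactly when the supremum is infinite).
Only the values of `f` on the open unit disk matter. -/
noncomputable def blochSeminorm (f : ℂ → ℂ) : ℝ≥0∞ :=
  ⨆ z ∈ Metric.ball (0 : ℂ) 1, ENNReal.ofReal ((1 - ‖z‖ ^ 2) * ‖deriv f z‖)

/-- The Bloch norm `|f(0)| + sup_{|z| < 1} (1 - |z|²) |f'(z)|`. An analytic function on the disk
belongs to the Bloch space exactly when this is finite. -/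
noncomputable def blochNorm (f : ℂ → ℂ) : ℝ≥0∞ :=
  ENNReal.ofReal ‖f 0‖ + blochSeminorm f

/-- `φ` is an analytic self-map of the open unit disk. -/
structure IsAnalyticSelfMap (φ : ℂ → ℂ) : Prop where
  analytic : AnalyticOnNhd ℂ φ (Metric.ball 0 1)
  mapsTo : Set.MapsTo φ (Metric.ball 0 1) (Metric.ball 0 1)

/-! The converse is the triangle inequality. For the direct implication, suppose the seminorms of `φ
^ n` do not tend to `0`. Then there are points `z k` where, for infinitely many `k`, `k |a|^k |A|`
stays bounded below, with `a = φ (z k)` and `A = (1 - |z k|) φ' (z k)`. Borel–Carathéodory and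
Cauchy bound `A`, and its second-order analogue `A₂`, by a multiple of `1 - |a|`; hence `k (1 -
|a|)` is bounded, and `a`, `a ^ k`, `k A`, `k A₂` converge along an ultrafilter. The same holds for
`ψ`.

A small Bloch norm also bounds the second derivative. Testing the combination at the same points
with exponents near `k` and `2k` gives five limit relations (`add_eq_zero_of_limit_relations`),
which force `lam₁ + lam₂ = 0`. -/

namespace IsAnalyticSelfMap

/-! ### Derivative estimates for self-maps of the disk -/

variable {φ : ℂ → ℂ} {z : ℂ}

lemma norm_lt_one (hφ : IsAnalyticSelfMap φ) (hz : ‖z‖ < 1) : ‖φ z‖ < 1 :=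
  mem_ball_zero_iff.1 (hφ.mapsTo (mem_ball_zero_iff.2 hz))

lemma analyticAt (hφ : IsAnalyticSelfMap φ) (hz : ‖z‖ < 1) : AnalyticAt ℂ φ z :=
  hφ.analytic z (mem_ball_zero_iff.2 hz)

/-- Borel–Carathéodory after a rotation `u` making `φ z` real and nonnegative: the real part of the
rotated increment is then at most `1 - ‖φ z‖`. -/
lemma norm_sub_le (hφ : IsAnalyticSelfMap φ) (hz : ‖z‖ < 1) {w : ℂ}
    (hw : ‖w‖ ≤ (1 - ‖z‖) / 2) : ‖φ (z + w) - φ z‖ ≤ 2 * (1 - ‖φ z‖) := by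
  have hR : 0 < 1 - ‖z‖ := by linarith
  have hM : 0 < 1 - ‖φ z‖ := by linarith [hφ.norm_lt_one hz]
  obtain ⟨u, hu, huz⟩ : ∃ u : ℂ, ‖u‖ = 1 ∧ u * φ z = (‖φ z‖ : ℂ) := by
    by_cases h : φ z = 0
    · exact ⟨1, by simp, by simp [h]⟩
    · have h' : (‖φ z‖ : ℂ) ≠ 0 := by simpa using h
      exact ⟨‖φ z‖ / φ z, by simp [h], by field_simp⟩
  have hball : ∀ x ∈ Metric.ball (0 : ℂ) (1 - ‖z‖), ‖z + x‖ < 1 := fun x hx => by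
    have := norm_add_le z x
    have := mem_ball_zero_iff.1 hx
    linarith
  have key := Complex.borelCaratheodory_zero (f := fun x => u * φ (z + x) - u * φ z) (z := w)
    hM (R := 1 - ‖z‖) ?_ ?_ hR (by rw [mem_ball_zero_iff]; linarith) (by simp)
  · rw [← mul_sub, norm_mul, hu, one_mul] at key
    refine key.trans ?_
    rw [div_le_iff₀ (by linarith)]
    nlinarith
  · intro x hx
    have h1 : DifferentiableAt ℂ (fun x => φ (z + x)) x :=
      (hφ.analyticAt (hball x hx)).differentiableAt.comp x (by fun_prop)
    exact ((h1.const_mul u).sub_const _).differentiableWithinAt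
  · intro x hx
    have h1 : (u * φ (z + x)).re ≤ 1 := by
      refine (Complex.re_le_norm _).trans ?_
      rw [norm_mul, hu, one_mul]
      exact (hφ.norm_lt_one (hball x hx)).le
    simp only [Set.mem_ofPred_eq, huz, Complex.sub_re, Complex.ofReal_re]
    linarith

lemma norm_iteratedDeriv_le (hφ : IsAnalyticSelfMap φ) (hz : ‖z‖ < 1) (n : ℕ) :
    ‖iteratedDeriv n (fun w => φ w - φ z) z‖ ≤
      n.factorial * (2 * (1 - ‖φ z‖)) / ((1 - ‖z‖) / 2) ^ n := by
  have hR : 0 < (1 - ‖z‖) / 2 := by linarith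
  refine Complex.norm_iteratedDeriv_le_of_forall_mem_sphere_norm_le n hR ?_ ?_
  · refine DifferentiableOn.diffContOnCl fun x hx => ?_
    have hx' : ‖x - z‖ ≤ (1 - ‖z‖) / 2 := by
      simpa [dist_eq_norm] using Metric.closure_ball_subset_closedBall hx
    have : ‖x‖ < 1 := by linarith [norm_le_norm_sub_add x z]
    exact ((hφ.analyticAt this).differentiableAt.sub_const _).differentiableWithinAt
  · intro x hx
    have := hφ.norm_sub_le hz (w := x - z) (mem_sphere_iff_norm.1 hx).le
    simpa using this

/-- Here 4 would suffice; 16 is the constant needed at second order, so that one `C` serves both. -/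
lemma norm_deriv_le (hφ : IsAnalyticSelfMap φ) (hz : ‖z‖ < 1) :
    (1 - ‖z‖) * ‖deriv φ z‖ ≤ 16 * (1 - ‖φ z‖) := by
  have hR : 0 < 1 - ‖z‖ := by linarith
  have h := hφ.norm_iteratedDeriv_le hz 1
  rw [iteratedDeriv_one, deriv_sub_const, le_div_iff₀ (by positivity)] at h
  norm_num at h
  linarith [hφ.norm_lt_one hz]

lemma norm_deriv_deriv_le (hφ : IsAnalyticSelfMap φ) (hz : ‖z‖ < 1) :
    (1 - ‖z‖) ^ 2 * ‖deriv (deriv φ) z‖ ≤ 16 * (1 - ‖φ z‖) := by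
  have hR : 0 < 1 - ‖z‖ := by linarith
  have h := hφ.norm_iteratedDeriv_le hz 2
  have e : deriv (fun w => φ w - φ z) = deriv φ := by ext; simp
  rw [iteratedDeriv_succ, iteratedDeriv_one, e, le_div_iff₀ (by positivity)] at h
  norm_num [Nat.factorial] at h
  linarith

end IsAnalyticSelfMap

/-! ### Derivatives controlled by the Bloch seminorm -/

lemma ofReal_le_blochSeminorm (f : ℂ → ℂ) {z : ℂ} (hz : ‖z‖ < 1) :
    ENNReal.ofReal ((1 - ‖z‖ ^ 2) * ‖deriv f z‖) ≤ blochSeminorm f :=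
  le_iSup₂ (f := fun z (_ : z ∈ Metric.ball (0 : ℂ) 1) =>
    ENNReal.ofReal ((1 - ‖z‖ ^ 2) * ‖deriv f z‖)) z (mem_ball_zero_iff.2 hz)

lemma one_sub_mul_norm_deriv_le {f : ℂ → ℂ} {ε : ℝ} (hε : 0 ≤ ε)
    (h : blochSeminorm f ≤ ENNReal.ofReal ε) {z : ℂ} (hz : ‖z‖ < 1) :
    (1 - ‖z‖) * ‖deriv f z‖ ≤ ε := by
  have h1 := (ENNReal.ofReal_le_ofReal_iff hε).1 ((ofReal_le_blochSeminorm f hz).trans h)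
  refine le_trans ?_ h1
  gcongr
  nlinarith [norm_nonneg z]

/-- Cauchy's estimate for `deriv f` on the circle of radius `(1 - ‖z‖) / 2`, where the distance to
the unit circle at most halves. -/
lemma one_sub_sq_mul_norm_deriv_deriv_le {f : ℂ → ℂ} (hf : AnalyticOnNhd ℂ f (Metric.ball 0 1))
    {ε : ℝ} (hε : 0 ≤ ε) (h : blochSeminorm f ≤ ENNReal.ofReal ε) {z : ℂ} (hz : ‖z‖ < 1) :
    (1 - ‖z‖) ^ 2 * ‖deriv (deriv f) z‖ ≤ 4 * ε := by
  have hR : 0 < (1 - ‖z‖) / 2 := by linarith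
  have hx : ∀ x ∈ Metric.closedBall z ((1 - ‖z‖) / 2), ‖x‖ ≤ (1 + ‖z‖) / 2 := fun x hx => by
    have hx' := mem_closedBall_iff_norm.1 hx
    linarith [norm_le_norm_sub_add x z]
  have key := Complex.norm_deriv_le_of_forall_mem_sphere_norm_le (f := deriv f) (c := z)
    (C := ε / ((1 - ‖z‖) / 2)) hR ?_ ?_
  · rw [le_div_iff₀ hR, le_div_iff₀ hR] at key
    linarith
  · refine DifferentiableOn.diffContOnCl fun x hx' => ?_
    have := hx x (Metric.closure_ball_subset_closedBall hx')
    exact (hf x (mem_ball_zero_iff.2 (by linarith))).deriv.differentiableAt.differentiableWithinAt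
  · intro x hx'
    have h1 := hx x (Metric.sphere_subset_closedBall hx')
    have h2 := one_sub_mul_norm_deriv_le hε h (z := x) (by linarith)
    rw [le_div_iff₀ hR]
    nlinarith [norm_nonneg (deriv f x)]

lemma deriv_mul_pow_add_mul_pow {φ ψ : ℂ → ℂ} {z : ℂ} (hφ : DifferentiableAt ℂ φ z)
    (hψ : DifferentiableAt ℂ ψ z) (lam₁ lam₂ : ℂ) (m : ℕ) :
    deriv (fun z => lam₁ * φ z ^ (m + 1) + lam₂ * ψ z ^ (m + 1)) z =
      (m + 1) * (lam₁ * (φ z ^ m * deriv φ z) + lam₂ * (ψ z ^ m * deriv ψ z)) := by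
  have h := ((hφ.hasDerivAt.pow (m + 1)).const_mul lam₁).add
    ((hψ.hasDerivAt.pow (m + 1)).const_mul lam₂)
  refine Eq.trans h.deriv ?_
  push_cast [Nat.add_sub_cancel]
  ring

lemma deriv_deriv_mul_pow_add_mul_pow {φ ψ : ℂ → ℂ} {z : ℂ} (hφ : AnalyticAt ℂ φ z)
    (hψ : AnalyticAt ℂ ψ z) (lam₁ lam₂ : ℂ) (m : ℕ) :
    deriv (deriv (fun z => lam₁ * φ z ^ (m + 2) + lam₂ * ψ z ^ (m + 2))) z =
      (m + 2) * (lam₁ * (φ z ^ (m + 1) * deriv (deriv φ) z + (m + 1) * φ z ^ m * deriv φ z ^ 2) +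
        lam₂ * (ψ z ^ (m + 1) * deriv (deriv ψ) z + (m + 1) * ψ z ^ m * deriv ψ z ^ 2)) := by
  have e : deriv (fun z => lam₁ * φ z ^ (m + 2) + lam₂ * ψ z ^ (m + 2)) =ᶠ[𝓝 z] fun z =>
      ((m + 1 : ℕ) + 1) * (lam₁ * (φ z ^ (m + 1) * deriv φ z) +
        lam₂ * (ψ z ^ (m + 1) * deriv ψ z)) := by
    filter_upwards [hφ.eventually_analyticAt, hψ.eventually_analyticAt] with w h1 h2
    exact deriv_mul_pow_add_mul_pow h1.differentiableAt h2.differentiableAt lam₁ lam₂ (m + 1)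
  rw [e.deriv_eq]
  have h1 := (hφ.differentiableAt.hasDerivAt.pow (m + 1)).mul hφ.deriv.differentiableAt.hasDerivAt
  have h2 := (hψ.differentiableAt.hasDerivAt.pow (m + 1)).mul hψ.deriv.differentiableAt.hasDerivAt
  refine Eq.trans
    (((h1.const_mul lam₁).add (h2.const_mul lam₂)).const_mul (((m + 1 : ℕ) : ℂ) + 1)).deriv ?_
  push_cast
  simp only [Pi.pow_apply]
  ring

/-! ### Compactness and the limit relations -/

/-- With `s = k (1 - r)` the hypotheses give `η ≤ C s e^{-s}`, and `e^s ≥ s² / 2` bounds `s`. -/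
lemma mul_one_sub_le_of_le_mul_pow {k : ℕ} {r B C η : ℝ} (hr : 0 ≤ r) (hr1 : r ≤ 1) (hη : 0 < η)
    (hC : 0 ≤ C) (hB : B ≤ C * (1 - r)) (h : η ≤ k * r ^ k * B) :
    k * (1 - r) ≤ 2 * C / η := by
  set s := k * (1 - r) with hs
  have hs0 : 0 ≤ s := mul_nonneg (by positivity) (by linarith)
  have h1 : r ^ k ≤ Real.exp (-s) := by
    calc r ^ k ≤ Real.exp (-(1 - r)) ^ k := by
          gcongr
          linarith [Real.add_one_le_exp (-(1 - r))]
      _ = Real.exp (-s) := by rw [← Real.exp_nat_mul, hs]; congr 1; ring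
  have h2 : η ≤ C * s * Real.exp (-s) := by
    calc η ≤ k * r ^ k * (C * (1 - r)) := h.trans (by gcongr)
      _ = C * s * r ^ k := by rw [hs]; ring
      _ ≤ _ := by gcongr
  rw [Real.exp_neg, ← div_eq_mul_inv, le_div_iff₀ (Real.exp_pos s)] at h2
  have h3 := Real.quadratic_le_exp_of_nonneg hs0
  have hspos : 0 < s := by
    rcases hs0.eq_or_lt with h0 | h0
    · rw [← h0] at h2; simp at h2; linarith
    · exact h0
  rw [le_div_iff₀ hη]
  have h4 : η * (s ^ 2 / 2) ≤ C * s := le_trans (by gcongr; linarith) h2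
  nlinarith

lemma Ultrafilter.exists_tendsto_of_eventually_norm_le {ι : Type*} (U : Ultrafilter ι) {f : ι → ℂ}
    {M : ℝ} (h : ∀ᶠ k in (U : Filter ι), ‖f k‖ ≤ M) :
    ∃ x, Tendsto f (U : Filter ι) (𝓝 x) := by
  obtain ⟨x, -, hx⟩ := (isCompact_closedBall (0 : ℂ) M).ultrafilter_le_nhds (U.map f)
    (le_principal_iff.2 (by
      rw [Ultrafilter.coe_map, Filter.mem_map]
      filter_upwards [h] with k hk
      simpa using hk))
  exact ⟨x, hx⟩

lemma add_eq_zero_of_limit_relations {lam₁ lam₂ P Q a b α β α₂ β₂ : ℂ} (h₁ : lam₁ ≠ 0)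
    (hPα : P * α ≠ 0)
    (e1 : lam₁ * (P * α) + lam₂ * (Q * β) = 0)
    (e2 : lam₁ * (P * a * α) + lam₂ * (Q * b * β) = 0)
    (e3 : lam₁ * (P ^ 2 * α) + lam₂ * (Q ^ 2 * β) = 0)
    (e4 : lam₁ * (P * a * α₂ + P * α ^ 2) + lam₂ * (Q * b * β₂ + Q * β ^ 2) = 0)
    (e5 : lam₁ * (P ^ 2 * a * α₂ + 2 * (P ^ 2 * α ^ 2)) +
      lam₂ * (Q ^ 2 * b * β₂ + 2 * (Q ^ 2 * β ^ 2)) = 0) :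
    lam₁ + lam₂ = 0 := by
  have hP : P ≠ 0 := left_ne_zero_of_mul hPα
  have hα : α ≠ 0 := right_ne_zero_of_mul hPα
  have hab : a = b := by
    have : lam₁ * (P * α) * (a - b) = 0 := by linear_combination e2 - b * e1
    exact sub_eq_zero.1 ((mul_eq_zero.1 this).resolve_left (mul_ne_zero h₁ hPα))
  have hPQ : P = Q := by
    have : lam₁ * (P * α) * (P - Q) = 0 := by linear_combination e3 - Q * e1
    exact sub_eq_zero.1 ((mul_eq_zero.1 this).resolve_left (mul_ne_zero h₁ hPα))
  subst hab hPQ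
  have f1 : lam₁ * α + lam₂ * β = 0 :=
    (mul_eq_zero.1 (show P * (lam₁ * α + lam₂ * β) = 0 by linear_combination e1)).resolve_left hP
  -- Once `a = b` and `P = Q`, subtracting `P` times `e4` from `e5` cancels the unknowns `α₂` and
  -- `β₂`.
  have f2 : lam₁ * α ^ 2 + lam₂ * β ^ 2 = 0 :=
    (mul_eq_zero.1 (show P ^ 2 * (lam₁ * α ^ 2 + lam₂ * β ^ 2) = 0 by
      linear_combination e5 - P * e4)).resolve_left (pow_ne_zero 2 hP)
  have f3 : lam₁ * α ^ 2 * (lam₁ + lam₂) = 0 := by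
    linear_combination lam₂ * f2 - (lam₂ * β - lam₁ * α) * f1
  exact (mul_eq_zero.1 f3).resolve_left (mul_ne_zero h₁ (pow_ne_zero 2 hα))

section Limits

variable {U : Ultrafilter ℕ} {a A : ℕ → ℂ} {C η : ℝ}

lemma eventually_natCast_mul_norm_le (hC : 0 ≤ C) (hη : 0 < η) (ha : ∀ k, ‖a k‖ ≤ 1)
    (hA : ∀ k, ‖A k‖ ≤ C * (1 - ‖a k‖))
    (h : ∀ᶠ k : ℕ in (U : Filter ℕ), η ≤ k * ‖a k‖ ^ k * ‖A k‖) {D : ℕ → ℂ}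
    (hD : ∀ k, ‖D k‖ ≤ C * (1 - ‖a k‖)) :
    ∀ᶠ k : ℕ in (U : Filter ℕ), ‖(k : ℂ) * D k‖ ≤ C * (2 * C / η) := by
  filter_upwards [h] with k hk
  have := mul_one_sub_le_of_le_mul_pow (norm_nonneg _) (ha k) hη hC (hA k) hk
  calc ‖(k : ℂ) * D k‖ = k * ‖D k‖ := by simp
    _ ≤ k * (C * (1 - ‖a k‖)) := by gcongr; exact hD k
    _ = C * (k * (1 - ‖a k‖)) := by ring
    _ ≤ _ := by gcongr

lemma exists_limits (hC : 0 ≤ C) (hη : 0 < η) (ha : ∀ k, ‖a k‖ ≤ 1)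
    (hA : ∀ k, ‖A k‖ ≤ C * (1 - ‖a k‖))
    (h : ∀ᶠ k : ℕ in (U : Filter ℕ), η ≤ k * ‖a k‖ ^ k * ‖A k‖) {A₂ : ℕ → ℂ}
    (hA₂ : ∀ k, ‖A₂ k‖ ≤ C * (1 - ‖a k‖)) :
    ∃ P x α α₂ : ℂ, Tendsto (fun k => a k ^ k) (U : Filter ℕ) (𝓝 P) ∧
      Tendsto a (U : Filter ℕ) (𝓝 x) ∧
      Tendsto (fun k : ℕ => (k : ℂ) * A k) (U : Filter ℕ) (𝓝 α) ∧
      Tendsto (fun k : ℕ => (k : ℂ) * A₂ k) (U : Filter ℕ) (𝓝 α₂) := by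
  obtain ⟨P, hP⟩ := U.exists_tendsto_of_eventually_norm_le (f := fun k => a k ^ k) (M := 1)
    (Eventually.of_forall fun k => by
      rw [norm_pow]; exact pow_le_one₀ (norm_nonneg _) (ha k))
  obtain ⟨x, hx⟩ := U.exists_tendsto_of_eventually_norm_le (Eventually.of_forall ha)
  obtain ⟨α, hα⟩ := U.exists_tendsto_of_eventually_norm_le
    (eventually_natCast_mul_norm_le hC hη ha hA h hA)
  obtain ⟨α₂, hα₂⟩ := U.exists_tendsto_of_eventually_norm_le
    (eventually_natCast_mul_norm_le hC hη ha hA h hA₂)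
  exact ⟨P, x, α, α₂, hP, hx, hα, hα₂⟩

lemma add_eq_zero_of_tendsto_ultrafilter {b B A₂ B₂ : ℕ → ℂ} {lam₁ lam₂ : ℂ}
    (hU : (U : Filter ℕ) ≤ atTop) (h₁ : lam₁ ≠ 0) (h₂ : lam₂ ≠ 0) (hC : 0 ≤ C) (hη : 0 < η)
    (ha : ∀ k, ‖a k‖ ≤ 1) (hb : ∀ k, ‖b k‖ ≤ 1)
    (hA : ∀ k, ‖A k‖ ≤ C * (1 - ‖a k‖)) (hB : ∀ k, ‖B k‖ ≤ C * (1 - ‖b k‖))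
    (hA₂ : ∀ k, ‖A₂ k‖ ≤ C * (1 - ‖a k‖)) (hB₂ : ∀ k, ‖B₂ k‖ ≤ C * (1 - ‖b k‖))
    (hlow : ∀ᶠ k : ℕ in (U : Filter ℕ), η ≤ k * ‖a k‖ ^ k * ‖A k‖)
    (E1 : ∀ s : ℕ → ℕ, (∀ k, k ≤ s k) → Tendsto (fun k : ℕ =>
      (k : ℂ) * (lam₁ * (a k ^ s k * A k) + lam₂ * (b k ^ s k * B k))) (U : Filter ℕ) (𝓝 0))
    (E2 : ∀ s : ℕ → ℕ, (∀ k, k ≤ s k) → Tendsto (fun k : ℕ =>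
      (k : ℂ) * (lam₁ * (a k ^ (s k + 1) * A₂ k + (s k + 1) * a k ^ s k * A k ^ 2) +
        lam₂ * (b k ^ (s k + 1) * B₂ k + (s k + 1) * b k ^ s k * B k ^ 2))) (U : Filter ℕ) (𝓝 0)) :
    lam₁ + lam₂ = 0 := by
  have n₁ : 0 < ‖lam₁‖ := norm_pos_iff.2 h₁
  have n₂ : 0 < ‖lam₂‖ := norm_pos_iff.2 h₂
  -- The `φ` term is bounded below and the sum tends to `0`, so the `ψ` term must balance it.
  have hlow' : ∀ᶠ k : ℕ in (U : Filter ℕ),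
      ‖lam₁‖ * η / (2 * ‖lam₂‖) ≤ k * ‖b k‖ ^ k * ‖B k‖ := by
    have hsmall := (E1 id fun k => le_rfl).norm.eventually_le_const
      (u := ‖lam₁‖ * η / 2) (by rw [norm_zero]; positivity)
    filter_upwards [hlow, hsmall] with k hk hk'
    have t := norm_sub_le ((k : ℂ) * (lam₁ * (a k ^ id k * A k) + lam₂ * (b k ^ id k * B k)))
      ((k : ℂ) * (lam₂ * (b k ^ id k * B k)))
    rw [show (k : ℂ) * (lam₁ * (a k ^ id k * A k) + lam₂ * (b k ^ id k * B k)) -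
      (k : ℂ) * (lam₂ * (b k ^ id k * B k)) = k * (lam₁ * (a k ^ id k * A k)) by ring] at t
    replace t := t.trans (add_le_add_left hk' _)
    simp only [norm_mul, norm_pow, id, Complex.norm_natCast] at t
    rw [div_le_iff₀ (by positivity)]
    have := mul_le_mul_of_nonneg_left hk n₁.le
    linarith
  obtain ⟨P, x, α, α₂, hP, hx, hα, hα₂⟩ := exists_limits hC hη ha hA hlow hA₂
  obtain ⟨Q, y, β, β₂, hQ, hy, hβ, hβ₂⟩ := exists_limits hC (by positivity) hb hB hlow' hB₂
  have hk0 : ∀ᶠ k : ℕ in (U : Filter ℕ), (k : ℂ) ≠ 0 :=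
    hU ((eventually_ne_atTop 0).mono fun k hk => Nat.cast_ne_zero.2 hk)
  have hinv : Tendsto (fun k : ℕ => ((k : ℂ))⁻¹) (U : Filter ℕ) (𝓝 0) :=
    (tendsto_inv_atTop_nhds_zero_nat (𝕜 := ℂ)).mono_left hU
  have hPα : P * α ≠ 0 := by
    have hge : η ≤ ‖P * α‖ := ge_of_tendsto (hP.mul hα).norm (by
      filter_upwards [hlow] with k hk
      refine hk.trans_eq ?_
      simp only [norm_mul, norm_pow, Complex.norm_natCast]
      ring)
    exact norm_pos_iff.1 (hη.trans_le hge)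
  refine add_eq_zero_of_limit_relations (P := P) (Q := Q) (a := x) (b := y) (α := α) (β := β)
    (α₂ := α₂) (β₂ := β₂) h₁ hPα ?_ ?_ ?_ ?_ ?_
  · refine tendsto_nhds_unique (((hP.mul hα).const_mul lam₁).add ((hQ.mul hβ).const_mul lam₂))
      ((E1 id fun k => le_rfl).congr fun k => ?_)
    simp only [id]
    ring
  · refine tendsto_nhds_unique ((((hP.mul hx).mul hα).const_mul lam₁).add
      (((hQ.mul hy).mul hβ).const_mul lam₂))
      ((E1 (fun k => k + 1) fun k => Nat.le_succ k).congr fun k => ?_)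
    ring
  · refine tendsto_nhds_unique ((((hP.pow 2).mul hα).const_mul lam₁).add
      (((hQ.pow 2).mul hβ).const_mul lam₂))
      ((E1 (fun k => k * 2) fun k => by omega).congr fun k => ?_)
    simp only [pow_mul]
    ring
  -- The coefficient `k (k + 1)` of `A ^ 2` is `k ^ 2 (1 + 1/k)`; for exponent `2k` it is `k ^ 2 (2
  -- + 1/k)`.
  · have hc : Tendsto (fun k : ℕ => 1 + ((k : ℂ))⁻¹) (U : Filter ℕ) (𝓝 1) := by
      simpa using hinv.const_add 1
    have hl := ((((hP.mul hx).mul hα₂).add (hc.mul (hP.mul (hα.pow 2)))).const_mul lam₁).add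
      ((((hQ.mul hy).mul hβ₂).add (hc.mul (hQ.mul (hβ.pow 2)))).const_mul lam₂)
    simp only [one_mul] at hl
    refine tendsto_nhds_unique hl ((E2 id fun k => le_rfl).congr' ?_)
    filter_upwards [hk0] with k hk
    simp only [id]
    field_simp
    ring
  · have hc : Tendsto (fun k : ℕ => 2 + ((k : ℂ))⁻¹) (U : Filter ℕ) (𝓝 2) := by
      simpa using hinv.const_add 2
    have hl := (((((hP.pow 2).mul hx).mul hα₂).add
      (hc.mul ((hP.pow 2).mul (hα.pow 2)))).const_mul lam₁).add
      (((((hQ.pow 2).mul hy).mul hβ₂).add (hc.mul ((hQ.pow 2).mul (hβ.pow 2)))).const_mul lam₂)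
    refine tendsto_nhds_unique hl ((E2 (fun k => k * 2) fun k => by omega).congr' ?_)
    filter_upwards [hk0] with k hk
    simp only [pow_add, pow_mul]
    push_cast
    field_simp

end Limits

/-! ### Application to combinations of powers -/

section PowerCombinations

variable {φ ψ : ℂ → ℂ} {lam₁ lam₂ : ℂ}

/-- The factor `s k + 1` produced by differentiation dominates `k`. Leaving `s` free allows several
exponents at the same points. -/
lemma tendsto_mul_first_derivative (hφ : IsAnalyticSelfMap φ) (hψ : IsAnalyticSelfMap ψ)
    (h : Tendsto (fun n : ℕ => blochNorm (fun z => lam₁ * φ z ^ n + lam₂ * ψ z ^ n)) atTop (𝓝 0))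
    {z : ℕ → ℂ} (hz : ∀ k, ‖z k‖ < 1) {s : ℕ → ℕ} (hs : ∀ k, k ≤ s k) :
    Tendsto (fun k : ℕ => (k : ℂ) *
      (lam₁ * (φ (z k) ^ s k * (((1 - ‖z k‖ : ℝ) : ℂ) * deriv φ (z k))) +
        lam₂ * (ψ (z k) ^ s k * (((1 - ‖z k‖ : ℝ) : ℂ) * deriv ψ (z k))))) atTop (𝓝 0) := by
  rw [NormedAddGroup.tendsto_nhds_zero]
  intro ε hε
  have hN : Tendsto (fun k => s k + 1) atTop atTop :=
    tendsto_atTop_mono (fun k => (hs k).trans (Nat.le_succ _)) tendsto_id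
  have hev := (h.comp hN).eventually_le_const (u := ENNReal.ofReal (ε / 2))
    (ENNReal.ofReal_pos.2 (by positivity))
  filter_upwards [hev] with k hk
  have hk' := one_sub_mul_norm_deriv_le (by positivity) (le_add_self.trans hk) (hz k)
  have hd : 0 < 1 - ‖z k‖ := by linarith [hz k]
  rw [deriv_mul_pow_add_mul_pow (hφ.analyticAt (hz k)).differentiableAt
    (hψ.analyticAt (hz k)).differentiableAt, norm_mul] at hk'
  have hc : ‖((s k : ℂ) + 1)‖ = s k + 1 := by
    rw [← Nat.cast_succ, Complex.norm_natCast, Nat.cast_succ]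
  rw [hc] at hk'
  have hsk : (k : ℝ) ≤ s k + 1 := by exact_mod_cast (hs k).trans (Nat.le_succ _)
  refine lt_of_le_of_lt ?_ (half_lt_self hε)
  refine le_trans ?_ hk'
  rw [show ∀ c x y p q : ℂ, lam₁ * (x * (c * p)) + lam₂ * (y * (c * q)) =
    c * (lam₁ * (x * p) + lam₂ * (y * q)) by intros; ring, norm_mul, norm_mul,
    Complex.norm_natCast, Complex.norm_real, Real.norm_of_nonneg hd.le, mul_left_comm]
  gcongr

lemma tendsto_mul_second_derivative (hφ : IsAnalyticSelfMap φ) (hψ : IsAnalyticSelfMap ψ)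
    (h : Tendsto (fun n : ℕ => blochNorm (fun z => lam₁ * φ z ^ n + lam₂ * ψ z ^ n)) atTop (𝓝 0))
    {z : ℕ → ℂ} (hz : ∀ k, ‖z k‖ < 1) {s : ℕ → ℕ} (hs : ∀ k, k ≤ s k) :
    Tendsto (fun k : ℕ => (k : ℂ) *
      (lam₁ * (φ (z k) ^ (s k + 1) * (((1 - ‖z k‖ : ℝ) : ℂ) ^ 2 * deriv (deriv φ) (z k)) +
          (s k + 1) * φ (z k) ^ s k * (((1 - ‖z k‖ : ℝ) : ℂ) * deriv φ (z k)) ^ 2) +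
        lam₂ * (ψ (z k) ^ (s k + 1) * (((1 - ‖z k‖ : ℝ) : ℂ) ^ 2 * deriv (deriv ψ) (z k)) +
          (s k + 1) * ψ (z k) ^ s k * (((1 - ‖z k‖ : ℝ) : ℂ) * deriv ψ (z k)) ^ 2)))
      atTop (𝓝 0) := by
  rw [NormedAddGroup.tendsto_nhds_zero]
  intro ε hε
  have hN : Tendsto (fun k => s k + 2) atTop atTop :=
    tendsto_atTop_mono (fun k => (hs k).trans (Nat.le_add_right _ _)) tendsto_id
  have hev := (h.comp hN).eventually_le_const (u := ENNReal.ofReal (ε / 8))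
    (ENNReal.ofReal_pos.2 (by positivity))
  filter_upwards [hev] with k hk
  have hf : AnalyticOnNhd ℂ (fun z => lam₁ * φ z ^ (s k + 2) + lam₂ * ψ z ^ (s k + 2))
      (Metric.ball 0 1) :=
    (analyticOnNhd_const.mul (hφ.analytic.pow _)).add (analyticOnNhd_const.mul (hψ.analytic.pow _))
  have hk' := one_sub_sq_mul_norm_deriv_deriv_le hf (by positivity) (le_add_self.trans hk) (hz k)
  have hd : 0 < 1 - ‖z k‖ := by linarith [hz k]
  rw [deriv_deriv_mul_pow_add_mul_pow (hφ.analyticAt (hz k)) (hψ.analyticAt (hz k)),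
    norm_mul] at hk'
  have hc : ‖((s k : ℂ) + 2)‖ = s k + 2 := by
    simpa using Complex.norm_natCast (s k + 2)
  rw [hc] at hk'
  have hsk : (k : ℝ) ≤ s k + 2 := by exact_mod_cast (hs k).trans (Nat.le_add_right _ _)
  refine lt_of_le_of_lt ?_ (half_lt_self hε)
  refine le_trans ?_ (hk'.trans_eq (by ring))
  rw [show ∀ c x p x' p' y q y' q' : ℂ, lam₁ * (x * (c ^ 2 * p) + x' * (c * p') ^ 2) +
      lam₂ * (y * (c ^ 2 * q) + y' * (c * q') ^ 2) =
    c ^ 2 * (lam₁ * (x * p + x' * p' ^ 2) + lam₂ * (y * q + y' * q' ^ 2)) by intros; ring,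
    norm_mul, norm_mul, norm_pow,
    Complex.norm_natCast, Complex.norm_real, Real.norm_of_nonneg hd.le, mul_left_comm]
  gcongr

lemma tendsto_blochSeminorm_pow_left (h₁ : lam₁ ≠ 0) (h₂ : lam₂ ≠ 0) (h₁₂ : lam₁ + lam₂ ≠ 0)
    (hφ : IsAnalyticSelfMap φ) (hψ : IsAnalyticSelfMap ψ)
    (h : Tendsto (fun n : ℕ => blochNorm (fun z => lam₁ * φ z ^ n + lam₂ * ψ z ^ n))
      atTop (𝓝 0)) :
    Tendsto (fun n : ℕ => blochSeminorm (fun z => φ z ^ n)) atTop (𝓝 0) := by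
  rw [← tendsto_add_atTop_iff_nat 1, ENNReal.tendsto_nhds_zero]
  by_contra! hcon
  obtain ⟨ε, hε, hfreq⟩ := hcon
  obtain ⟨η, hη, hηε⟩ : ∃ η : ℝ, 0 < η ∧ ENNReal.ofReal η ≤ ε := by
    obtain ⟨r, hr, hrε⟩ := ENNReal.lt_iff_exists_nnreal_btwn.1 hε
    exact ⟨r, by exact_mod_cast hr, by simpa using hrε.le⟩
  have hpt : ∀ k : ℕ, ∃ z : ℂ, ‖z‖ < 1 ∧ (ε < blochSeminorm (fun z => φ z ^ (k + 1)) →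
      η ≤ (1 - ‖z‖ ^ 2) * ‖deriv (fun z => φ z ^ (k + 1)) z‖) := by
    intro k
    by_cases hk : ε < blochSeminorm (fun z => φ z ^ (k + 1))
    · rw [blochSeminorm, lt_iSup_iff] at hk
      obtain ⟨z, hk⟩ := hk
      rw [lt_iSup_iff] at hk
      obtain ⟨hz, hk⟩ := hk
      refine ⟨z, mem_ball_zero_iff.1 hz, fun _ => ?_⟩
      exact ((ENNReal.ofReal_lt_ofReal_iff_of_nonneg hη.le).1 (hηε.trans_lt hk)).le
    -- Dummy point: such indices lie outside the set on which the ultrafilter concentrates.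
    · exact ⟨0, by simp, fun h => absurd h hk⟩
  choose z hz hzη using hpt
  have hne : (atTop ⊓ 𝓟 {k | ε < blochSeminorm (fun z => φ z ^ (k + 1))}).NeBot :=
    frequently_mem_iff_neBot.1 hfreq
  obtain ⟨U, hUle⟩ := Ultrafilter.exists_le
    (atTop ⊓ 𝓟 {k | ε < blochSeminorm (fun z => φ z ^ (k + 1))})
  have hU : (U : Filter ℕ) ≤ atTop := hUle.trans inf_le_left
  have hUS : ∀ᶠ k in (U : Filter ℕ), ε < blochSeminorm (fun z => φ z ^ (k + 1)) :=
    le_principal_iff.1 (hUle.trans inf_le_right)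
  have hd : ∀ k, 0 < 1 - ‖z k‖ := fun k => by linarith [hz k]
  have hnorm : ∀ k, ∀ w : ℂ, ‖((1 - ‖z k‖ : ℝ) : ℂ) * w‖ = (1 - ‖z k‖) * ‖w‖ := fun k w => by
    rw [norm_mul, Complex.norm_real, Real.norm_of_nonneg (hd k).le]
  have hnorm2 : ∀ k, ∀ w : ℂ, ‖((1 - ‖z k‖ : ℝ) : ℂ) ^ 2 * w‖ = (1 - ‖z k‖) ^ 2 * ‖w‖ :=
    fun k w => by rw [norm_mul, norm_pow, Complex.norm_real, Real.norm_of_nonneg (hd k).le]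
  refine h₁₂ (add_eq_zero_of_tendsto_ultrafilter (U := U) (C := 16) (η := η / 4)
    (a := fun k => φ (z k)) (b := fun k => ψ (z k))
    (A := fun k => ((1 - ‖z k‖ : ℝ) : ℂ) * deriv φ (z k))
    (B := fun k => ((1 - ‖z k‖ : ℝ) : ℂ) * deriv ψ (z k))
    (A₂ := fun k => ((1 - ‖z k‖ : ℝ) : ℂ) ^ 2 * deriv (deriv φ) (z k))
    (B₂ := fun k => ((1 - ‖z k‖ : ℝ) : ℂ) ^ 2 * deriv (deriv ψ) (z k))
    hU h₁ h₂ (by norm_num) (by positivity)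
    (fun k => (hφ.norm_lt_one (hz k)).le) (fun k => (hψ.norm_lt_one (hz k)).le)
    (fun k => (hnorm k _).trans_le (hφ.norm_deriv_le (hz k)))
    (fun k => (hnorm k _).trans_le (hψ.norm_deriv_le (hz k)))
    (fun k => (hnorm2 k _).trans_le (hφ.norm_deriv_deriv_le (hz k)))
    (fun k => (hnorm2 k _).trans_le (hψ.norm_deriv_deriv_le (hz k))) ?_
    (fun s hs => (tendsto_mul_first_derivative hφ hψ h hz hs).mono_left hU)
    (fun s hs => (tendsto_mul_second_derivative hφ hψ h hz hs).mono_left hU))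
  filter_upwards [hUS, hU (eventually_ge_atTop 1)] with k hk hk1
  have hη' := hzη k hk
  have e : deriv (fun z => φ z ^ (k + 1)) (z k) = _ :=
    ((hφ.analyticAt (hz k)).differentiableAt.hasDerivAt.pow (k + 1)).deriv
  rw [e, norm_mul, norm_mul, norm_pow, Complex.norm_natCast, Nat.add_sub_cancel] at hη'
  have hk1' : (1 : ℝ) ≤ k := by exact_mod_cast hk1
  rw [hnorm]
  -- The two factors 2, here and in `e2`, account for `η / 4`.
  have e1 : 1 - ‖z k‖ ^ 2 ≤ 2 * (1 - ‖z k‖) := by nlinarith [sq_nonneg (1 - ‖z k‖)]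
  have e2 : ((k + 1 : ℕ) : ℝ) ≤ 2 * k := by push_cast; linarith
  have e3 : η ≤ 2 * (1 - ‖z k‖) * (2 * k * ‖φ (z k)‖ ^ k * ‖deriv φ (z k)‖) :=
    hη'.trans (by have := hd k; gcongr)
  linarith

lemma tendsto_blochNorm_pow (hφ : IsAnalyticSelfMap φ)
    (h : Tendsto (fun n : ℕ => blochSeminorm (fun z => φ z ^ n)) atTop (𝓝 0)) :
    Tendsto (fun n : ℕ => blochNorm (fun z => φ z ^ n)) atTop (𝓝 0) := by
  have h0 : Tendsto (fun n : ℕ => ENNReal.ofReal ‖φ 0 ^ n‖) atTop (𝓝 0) := by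
    have := (tendsto_pow_atTop_nhds_zero_of_norm_lt_one (hφ.norm_lt_one (z := 0) (by simp))).norm
    simpa using ENNReal.tendsto_ofReal this
  simpa [blochNorm] using h0.add h

lemma blochNorm_mul_pow_add_mul_pow_le (hφ : IsAnalyticSelfMap φ) (hψ : IsAnalyticSelfMap ψ)
    (n : ℕ) :
    blochNorm (fun z => lam₁ * φ z ^ n + lam₂ * ψ z ^ n) ≤
      ENNReal.ofReal ‖lam₁‖ * blochNorm (fun z => φ z ^ n) +
        ENNReal.ofReal ‖lam₂‖ * blochNorm (fun z => ψ z ^ n) := by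
  have key : ∀ (r : ℝ) (u v : ℂ), 0 ≤ r → ENNReal.ofReal (r * ‖lam₁ * u + lam₂ * v‖) ≤
      ENNReal.ofReal ‖lam₁‖ * ENNReal.ofReal (r * ‖u‖) +
        ENNReal.ofReal ‖lam₂‖ * ENNReal.ofReal (r * ‖v‖) := by
    intro r u v hr
    rw [← ENNReal.ofReal_mul (norm_nonneg _), ← ENNReal.ofReal_mul (norm_nonneg _),
      ← ENNReal.ofReal_add (by positivity) (by positivity)]
    refine ENNReal.ofReal_le_ofReal ?_
    calc r * ‖lam₁ * u + lam₂ * v‖ ≤ r * (‖lam₁‖ * ‖u‖ + ‖lam₂‖ * ‖v‖) := by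
          gcongr
          exact (norm_add_le _ _).trans_eq (by rw [norm_mul, norm_mul])
      _ = _ := by ring
  have h0 := key 1 (φ 0 ^ n) (ψ 0 ^ n) zero_le_one
  simp only [one_mul] at h0
  have hs : blochSeminorm (fun z => lam₁ * φ z ^ n + lam₂ * ψ z ^ n) ≤
      ENNReal.ofReal ‖lam₁‖ * blochSeminorm (fun z => φ z ^ n) +
        ENNReal.ofReal ‖lam₂‖ * blochSeminorm (fun z => ψ z ^ n) := by
    refine iSup₂_le fun z hz => ?_
    have hz' := mem_ball_zero_iff.1 hz
    have d1 : DifferentiableAt ℂ (fun z => φ z ^ n) z := (hφ.analyticAt hz').differentiableAt.pow n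
    have d2 : DifferentiableAt ℂ (fun z => ψ z ^ n) z := (hψ.analyticAt hz').differentiableAt.pow n
    have e : deriv (fun z => lam₁ * φ z ^ n + lam₂ * ψ z ^ n) z =
        lam₁ * deriv (fun z => φ z ^ n) z + lam₂ * deriv (fun z => ψ z ^ n) z :=
      ((d1.hasDerivAt.const_mul lam₁).add (d2.hasDerivAt.const_mul lam₂)).deriv
    rw [e]
    refine (key _ _ _ (by nlinarith [norm_nonneg z])).trans ?_
    gcongr <;> exact ofReal_le_blochSeminorm _ hz'
  refine (add_le_add h0 hs).trans_eq ?_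
  simp only [blochNorm]
  ring

end PowerCombinations

theorem corollary2 (lam₁ lam₂ : ℂ) (h₁ : lam₁ ≠ 0) (h₂ : lam₂ ≠ 0) (h₁₂ : lam₁ + lam₂ ≠ 0)
    (φ ψ : ℂ → ℂ) (hφ : IsAnalyticSelfMap φ) (hψ : IsAnalyticSelfMap ψ) :
    Tendsto (fun n : ℕ => blochNorm (fun z => lam₁ * φ z ^ n + lam₂ * ψ z ^ n)) atTop (𝓝 0) ↔
      (Tendsto (fun n : ℕ => blochNorm (fun z => φ z ^ n)) atTop (𝓝 0) ∧
        Tendsto (fun n : ℕ => blochNorm (fun z => ψ z ^ n)) atTop (𝓝 0)) := by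
  constructor
  · intro h
    refine ⟨tendsto_blochNorm_pow hφ (tendsto_blochSeminorm_pow_left h₁ h₂ h₁₂ hφ hψ h),
      tendsto_blochNorm_pow hψ (tendsto_blochSeminorm_pow_left h₂ h₁ (by rwa [add_comm]) hψ hφ ?_)⟩
    simpa only [add_comm] using h
  · rintro ⟨hl, hr⟩
    have hsum := (ENNReal.Tendsto.const_mul hl (a := ENNReal.ofReal ‖lam₁‖)
      (Or.inr ENNReal.ofReal_ne_top)).add (ENNReal.Tendsto.const_mul hr
        (a := ENNReal.ofReal ‖lam₂‖) (Or.inr ENNReal.ofReal_ne_top))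
    simp only [mul_zero, add_zero] at hsum
    exact tendsto_of_tendsto_of_tendsto_of_le_of_le tendsto_const_nhds hsum (fun _ => zero_le)
      fun n => blochNorm_mul_pow_add_mul_pow_le hφ hψ n
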